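/- Conventions. Hilbert spaces are complex and separable, with inner product linear in the second entry; $\mathcal L(\mathcal H)$ denotes the bounded operators on $\mathcal H$. For von Neumann algebras $\mathcal M,\mathcal N$ let $\mathrm{CB}(\mathcal M,\mathcal N)$ be the linear space of weak*-continuous completely bounded maps $\mathcal M\to\mathcal N$, $\mathrm{CP}(\mathcal M,\mathcal N)$ the set of normal completely positive maps, and $\mathrm{CP}_1(\mathcal M,\mathcal N)$ the set of quantum channels (unital elements of $\mathrm{CP}(\mathcal M,\mathcal N)$). For $\mathcal E,\mathcal E'\in\mathrm{CB}(\mathcal M,\mathcal N)$ write $\mathcal E\preceq\mathcal E'$ if $\mathcal E'-\mathcal E\in\mathrm{CP}(\mathcal M,\mathcal N)$, and write $\mathcal E_n\Uparrow\mathcal E$ if $(\mathcal E_n)$ is a $\preceq$-increasing sequence in $\mathrm{CP}(\mathcal M,\mathcal N)$ that is $\preceq$-bounded by an element of $\mathrm{CP}(\mathcal M,\mathcal N)$, $\mathcal E\in\mathrm{CP}(\mathcal M,\mathcal N)$, and $\mathcal E_n(A)\to\mathcal E(A)$ weak* for all $A\in\mathcal M$. Let $\mathcal M_1\subset\mathcal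 L(\mathcal H_1)$ with $\mathcal H_1\neq 0$ and $\mathcal M_2\subset\mathcal L(\mathcal H_2)$ be von Neumann algebras and let $\mathcal K_1,\mathcal K_2$ be Hilbert spaces. A deterministic supermap is a linear map $\mathsf S:\mathrm{CB}(\mathcal M_1,\mathcal L(\mathcal K_1))\to\mathrm{CB}(\mathcal M_2,\mathcal L(\mathcal K_2))$ which is - completely positive: for every $n$ the map $\mathsf I_n\otimes\mathsf S$, where $\mathsf I_n$ is the identity of $\mathrm{CB}(M_n(\mathbb C),M_n(\mathbb C))$ and $\mathrm{CB}(M_n(\mathbb C)\bar\otimes\mathcal M_i,M_n(\mathbb C)\bar\otimes\mathcal L(\mathcal K_i))$ is identified with the algebraic tensor product of $\mathrm{CB}(M_n(\mathbb C),M_n(\mathbb C))$ and $\mathrm{CB}(\mathcal M_i,\mathcal L(\mathcal K_i))$, sends normal completely positive maps to normal completely positive maps; - normal: $\mathcal E_n\Uparrow\mathcal E$ implies $\mathsf S(\mathcal E_n)\Uparrow\mathsf S(\mathcal E)$; - channel preserving: $\mathsf S$ maps $\mathrm{CP}_1(\mathcal M_1,\mathcal L(\mathcal K_1))$ into $\mathrm{CP}_1(\mathcal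 M_2,\mathcal L(\mathcal K_2))$. A dilation of $\mathsf S$ is a triple $(\mathcal V,V,\mathcal F)$ of a Hilbert space $\mathcal V$, an isometry $V:\mathcal K_2\to\mathcal K_1\otimes\mathcal V$ and a quantum channel $\mathcal F\in\mathrm{CP}_1(\mathcal M_2,\mathcal M_1\bar\otimes\mathcal L(\mathcal V))$ such that $$[\mathsf S(\mathcal E)](A)=V^*\,[(\mathcal E\otimes\iota_{\mathcal V})(\mathcal F(A))]\,V\qquad\text{for all }\mathcal E\in\mathrm{CB}(\mathcal M_1,\mathcal L(\mathcal K_1)),\ A\in\mathcal M_2,$$ where $\mathcal E\otimes\iota_{\mathcal V}:\mathcal M_1\bar\otimes\mathcal L(\mathcal V)\to\mathcal L(\mathcal K_1\otimes\mathcal V)$ is the weak*-continuous completely bounded map with $A\otimes B\mapsto\mathcal E(A)\otimes B$. The dilation is minimal if $\mathcal V$ is the closed linear span of the vectors $(u^*\otimes I_{\mathcal V})Vv$ with $u\in\mathcal K_1$, $v\in\mathcal K_2$, where $u^*=\langle u,\cdot\rangle$. Proposition. Let $(\mathcal V,V,\mathcal F)$ and $(\mathcal V',V',\mathcal F')$ be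 two dilations of the deterministic supermap $\mathsf S$, and suppose that $(\mathcal V,V,\mathcal F)$ is minimal. Then there exists a unique isometry $W:\mathcal V\to\mathcal V'$ such that $V'=(I_{\mathcal K_1}\otimes W)V$. Moreover, $$\mathcal F(A)=(I_{\mathcal H_1}\otimes W^*)\,\mathcal F'(A)\,(I_{\mathcal H_1}\otimes W)\qquad\text{for all }A\in\mathcal M_2.$$ If $(\mathcal V',V',\mathcal F')$ is also minimal, then $W$ is unitary, and hence $\mathcal F'(A)=(I_{\mathcal H_1}\otimes W)\,\mathcal F(A)\,(I_{\mathcal H_1}\otimes W^*)$ for all $A\in\mathcal M_2$; that is, minimal dilations are unique up to unitary equivalence. -/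

import Mathlib

open scoped TensorProduct InnerProductSpace

noncomputable section

namespace QSupermap

section HilbertTensor

variable {H : Type*} [NormedAddCommGroup H] [InnerProductSpace ℂ H]
variable {K : Type*} [NormedAddCommGroup K] [InnerProductSpace ℂ K]
variable {H' : Type*} [NormedAddCommGroup H'] [InnerProductSpace ℂ H']
variable {K' : Type*} [NormedAddCommGroup K'] [InnerProductSpace ℂ K']

/-- The Hilbert space tensor product `H ⊗ K`: the completion of the algebraic tensor product. -/
abbrev HTensor (H : Type*) [NormedAddCommGroup H] [InnerProductSpace ℂ H]
    (K : Type*) [NormedAddCommGroup K] [InnerProductSpace ℂ K] : Type _ :=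
  UniformSpace.Completion (H ⊗[ℂ] K)

/-- The elementary tensor `x ⊗ y` in the Hilbert space tensor product. -/
def htmul (x : H) (y : K) : HTensor H K := ((x ⊗ₜ[ℂ] y : H ⊗[ℂ] K) : HTensor H K)

/-- The bounded operator `A ⊗ B : H ⊗ K → H' ⊗ K'`. -/
def opTensor (A : H →L[ℂ] H') (B : K →L[ℂ] K') : HTensor H K →L[ℂ] HTensor H' K' :=
  (TensorProduct.mapL A B).completion

/-- The operator `K → H ⊗ K`, `y ↦ x ⊗ y`. -/
def insL (K : Type*) [NormedAddCommGroup K] [InnerProductSpace ℂ K] (x : H) :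
    K →L[ℂ] HTensor H K :=
  UniformSpace.Completion.toComplL.comp (TensorProduct.mkL ℂ H K x)

/-- The operator `H → H ⊗ K`, `x ↦ x ⊗ y`. -/
def insR (H : Type*) [NormedAddCommGroup H] [InnerProductSpace ℂ H] (y : K) :
    H →L[ℂ] HTensor H K :=
  UniformSpace.Completion.toComplL.comp ((TensorProduct.mkL ℂ H K).flip y)

@[simp] theorem opTensor_htmul (A : H →L[ℂ] H') (B : K →L[ℂ] K') (x : H) (y : K) :
    opTensor A B (htmul x y) = htmul (A x) (B y) := by
  simp [opTensor, htmul]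

@[simp] theorem insL_apply (x : H) (y : K) : insL K x y = htmul x y := rfl

@[simp] theorem insR_apply (x : H) (y : K) : insR H y x = htmul x y := rfl

@[simp] theorem inner_htmul (x x' : H) (y y' : K) :
    ⟪htmul x y, htmul x' y'⟫_ℂ = ⟪x, x'⟫_ℂ * ⟪y, y'⟫_ℂ := by
  simp [htmul]

theorem insL_add (x x' : H) : insL K (x + x') = insL K x + insL K x' := by
  simp only [insL, map_add, ContinuousLinearMap.comp_add]

theorem insL_smul (c : ℂ) (x : H) : insL K (c • x) = c • insL K x := by
  simp only [insL, map_smul, ContinuousLinearMap.comp_smul]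

theorem insR_add (y y' : K) : insR H (y + y') = insR H y + insR H y' := by
  simp only [insR, map_add, ContinuousLinearMap.comp_add]

theorem insR_smul (c : ℂ) (y : K) : insR H (c • y) = c • insR H y := by
  simp only [insR, map_smul, ContinuousLinearMap.comp_smul]

/-- Bounded operators that agree on elementary tensors are equal. -/
theorem hext {G : Type*} [NormedAddCommGroup G] [NormedSpace ℂ G]
    {A B : HTensor H K →L[ℂ] G} (h : ∀ x y, A (htmul x y) = B (htmul x y)) : A = B := by
  ext z
  refine UniformSpace.Completion.induction_on z
    (isClosed_eq A.continuous B.continuous) fun w => ?_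
  induction w with
  | zero => rw [UniformSpace.Completion.coe_zero, map_zero, map_zero]
  | tmul x y => exact h x y
  | add a b ha hb => rw [UniformSpace.Completion.coe_add, map_add, map_add, ha, hb]

/-- Vectors with the same inner products with all elementary tensors are equal. -/
theorem hext_inner {z z' : HTensor H K}
    (h : ∀ x y, ⟪htmul x y, z⟫_ℂ = ⟪htmul x y, z'⟫_ℂ) : z = z' := by
  have : innerSL ℂ z = innerSL ℂ z' := hext fun x y => by
    simpa using congrArg (starRingEnd ℂ) (h x y)
  refine ext_inner_right ℂ fun v => ?_
  simpa using congrArg (fun f => f v) this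

/-- The operator `u* ⊗ I : H ⊗ K → K`, where `u* = ⟪u, ·⟫`; see `contractL_htmul`. -/
def contractL (K : Type*) [NormedAddCommGroup K] [InnerProductSpace ℂ K] [CompleteSpace K]
    (u : H) : HTensor H K →L[ℂ] K :=
  ContinuousLinearMap.adjoint (insL K u)

/-- The operator `I ⊗ v* : H ⊗ K → H`; see `contractR_htmul`. -/
def contractR (H : Type*) [NormedAddCommGroup H] [InnerProductSpace ℂ H] [CompleteSpace H]
    (v : K) : HTensor H K →L[ℂ] H :=
  ContinuousLinearMap.adjoint (insR H v)

@[simp] theorem contractL_htmul [CompleteSpace K] (u x : H) (y : K) :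
    contractL K u (htmul x y) = ⟪u, x⟫_ℂ • y := by
  refine ext_inner_left ℂ fun w => ?_
  simp [contractL, ContinuousLinearMap.adjoint_inner_right, inner_smul_right]

@[simp] theorem contractR_htmul [CompleteSpace H] (v : K) (x : H) (y : K) :
    contractR H v (htmul x y) = ⟪v, y⟫_ℂ • x := by
  refine ext_inner_left ℂ fun w => ?_
  simp [contractR, ContinuousLinearMap.adjoint_inner_right, inner_smul_right, mul_comm]

end HilbertTensor

section VonNeumann

variable {H : Type*} [NormedAddCommGroup H] [InnerProductSpace ℂ H] [CompleteSpace H]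
variable {G : Type*} [NormedAddCommGroup G] [InnerProductSpace ℂ G] [CompleteSpace G]
variable {K : Type*} [NormedAddCommGroup K] [InnerProductSpace ℂ K] [CompleteSpace K]

instance : SMulMemClass (VonNeumannAlgebra H) ℂ (H →L[ℂ] H) where
  smul_mem {s} c _ hx := s.toStarSubalgebra.smul_mem hx c

/-- The von Neumann algebra `L(H)` of all bounded operators on `H`. -/
def fullVN (H : Type*) [NormedAddCommGroup H] [InnerProductSpace ℂ H] [CompleteSpace H] :
    VonNeumannAlgebra H where
  toStarSubalgebra := ⊤
  centralizer_centralizer' := Set.eq_univ_of_univ_subset Set.subset_centralizer_centralizer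

theorem mem_fullVN (A : H →L[ℂ] H) : A ∈ fullVN H := Set.mem_univ A

/-- The von Neumann algebra generated by a set of operators:
the bicommutant of the set together with its adjoints. -/
def vnGen (S : Set (H →L[ℂ] H)) : VonNeumannAlgebra H where
  toStarSubalgebra := StarSubalgebra.centralizer ℂ (S ∪ star S).centralizer
  centralizer_centralizer' := by
    change Set.centralizer (Set.centralizer (Set.centralizer _)) = Set.centralizer _
    exact Set.centralizer_centralizer_centralizer _

theorem mem_vnGen_iff {S : Set (H →L[ℂ] H)} {X : H →L[ℂ] H} :
    X ∈ vnGen S ↔ ∀ B, (∀ A ∈ S, A * B = B * A ∧ star A * B = B * star A) → B * X = X * B := by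
  have key : ∀ B, B ∈ (S ∪ star S).centralizer ↔
      ∀ A ∈ S, A * B = B * A ∧ star A * B = B * star A := by
    intro B
    rw [Set.mem_centralizer_iff]
    constructor
    · intro h A hA
      exact ⟨h A (Or.inl hA), h (star A) (Or.inr (by simpa using hA))⟩
    · rintro h A (hA | hA)
      · exact (h A hA).1
      · simpa using (h (star A) hA).2
  have hstar : ∀ B, B ∈ (S ∪ star S).centralizer → star B ∈ (S ∪ star S).centralizer :=
    fun B hB => Set.star_mem_centralizer hB
  constructor
  · intro h B hB
    exact (StarSubalgebra.mem_centralizer_iff ℂ |>.1 h B ((key B).2 hB)).1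
  · intro h
    exact (StarSubalgebra.mem_centralizer_iff ℂ).2 fun B hB =>
      ⟨h B ((key B).1 hB), h (star B) ((key _).1 (hstar B hB))⟩

/-- The von Neumann algebra tensor product `N ⊗̄ M`,
generated by the operators `A ⊗ B` with `A ∈ N` and `B ∈ M`. -/
def vnTensor (N : VonNeumannAlgebra G) (M : VonNeumannAlgebra H) :
    VonNeumannAlgebra (HTensor G H) :=
  vnGen {X | ∃ A ∈ N, ∃ B ∈ M, X = opTensor A B}

theorem opTensor_mem (N : VonNeumannAlgebra G) (M : VonNeumannAlgebra H)
    {A : G →L[ℂ] G} {B : H →L[ℂ] H} (hA : A ∈ N) (hB : B ∈ M) :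
    opTensor A B ∈ vnTensor N M :=
  mem_vnGen_iff.2 fun _ hC => ((hC _ ⟨A, hA, B, hB, rfl⟩).1).symm

theorem opTensor_adjoint (A : G →L[ℂ] G) (B : H →L[ℂ] H) :
    star (opTensor A B) = opTensor (star A) (star B) := by
  refine hext fun x y => hext_inner fun x' y' => ?_
  simp [ContinuousLinearMap.star_eq_adjoint, ContinuousLinearMap.adjoint_inner_right]

theorem mem_vnTensor_commute (N : VonNeumannAlgebra G) (M : VonNeumannAlgebra H)
    {X : HTensor G H →L[ℂ] HTensor G H} (hX : X ∈ vnTensor N M)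
    {A : G →L[ℂ] G} {B : H →L[ℂ] H}
    (hA : A ∈ N.commutant) (hB : B ∈ M.commutant) :
    opTensor A B * X = X * opTensor A B := by
  refine mem_vnGen_iff.1 hX _ ?_
  rintro _ ⟨A', hA', B', hB', rfl⟩
  rw [opTensor_adjoint]
  have h1 := VonNeumannAlgebra.mem_commutant_iff.1 hA
  have h2 := VonNeumannAlgebra.mem_commutant_iff.1 hB
  have e : ∀ (P P' : G →L[ℂ] G) (Q Q' : H →L[ℂ] H), P * P' = P' * P → Q * Q' = Q' * Q →
      opTensor P Q * opTensor P' Q' = opTensor P' Q' * opTensor P Q := by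
    intro P P' Q Q' hP hQ
    refine hext fun x y => ?_
    have hp := congrArg (fun f => f x) hP
    have hq := congrArg (fun f => f y) hQ
    simp only [mul_apply_eq_comp] at hp hq
    simp [hp, hq]
  exact ⟨e _ _ _ _ (h1 _ hA') (h2 _ hB'), e _ _ _ _ (h1 _ (star_mem hA')) (h2 _ (star_mem hB'))⟩

/-- The left slice `(ω ⊗ ι)(X) ∈ M` of `X ∈ N ⊗̄ M`, where `ω = ⟪x, · y⟫`:
the operator `h ↦ (x* ⊗ I) X (y ⊗ h)`. -/
def sliceL (N : VonNeumannAlgebra G) (M : VonNeumannAlgebra H) (x y : G) :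
    vnTensor N M →ₗ[ℂ] M where
  toFun X := ⟨(contractL H x).comp ((X : HTensor G H →L[ℂ] HTensor G H).comp (insL H y)), by
    refine (congrArg (_ ∈ ·) M.commutant_commutant).mp
      (VonNeumannAlgebra.mem_commutant_iff.2 ?_)
    intro B hB
    have h := mem_vnTensor_commute N M X.2 (one_mem N.commutant) hB
    ext w
    refine ext_inner_left ℂ fun v => ?_
    have h' := congrArg (fun f => ⟪htmul x v, f (htmul y w)⟫_ℂ) h
    simp only [mul_apply_eq_comp, opTensor_htmul, one_apply_eq_self] at h'
    rw [← ContinuousLinearMap.adjoint_inner_left, ← ContinuousLinearMap.star_eq_adjoint,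
      opTensor_adjoint] at h'
    simpa [contractL, ContinuousLinearMap.adjoint_inner_right,
      ← ContinuousLinearMap.adjoint_inner_left B, ContinuousLinearMap.star_eq_adjoint] using h'⟩
  map_add' X Y := by
    ext w
    simp
  map_smul' c X := by
    ext w
    simp

/-- The right slice `(ι ⊗ ω)(X) ∈ M` of `X ∈ M ⊗̄ N`, where `ω = ⟪x, · y⟫`:
the operator `h ↦ (I ⊗ x*) X (h ⊗ y)`. -/
def sliceR (M : VonNeumannAlgebra H) (N : VonNeumannAlgebra G) (x y : G) :
    vnTensor M N →ₗ[ℂ] M where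
  toFun X := ⟨(contractR H x).comp ((X : HTensor H G →L[ℂ] HTensor H G).comp (insR H y)), by
    refine (congrArg (_ ∈ ·) M.commutant_commutant).mp
      (VonNeumannAlgebra.mem_commutant_iff.2 ?_)
    intro B hB
    have h := mem_vnTensor_commute M N X.2 hB (one_mem N.commutant)
    ext w
    refine ext_inner_left ℂ fun v => ?_
    have h' := congrArg (fun f => ⟪htmul v x, f (htmul w y)⟫_ℂ) h
    simp only [mul_apply_eq_comp, opTensor_htmul, one_apply_eq_self] at h'
    rw [← ContinuousLinearMap.adjoint_inner_left, ← ContinuousLinearMap.star_eq_adjoint,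
      opTensor_adjoint] at h'
    simpa [contractR, ContinuousLinearMap.adjoint_inner_right,
      ← ContinuousLinearMap.adjoint_inner_left B, ContinuousLinearMap.star_eq_adjoint] using h'⟩
  map_add' X Y := by
    ext w
    simp
  map_smul' c X := by
    ext w
    simp

theorem inner_sliceL (N : VonNeumannAlgebra G) (M : VonNeumannAlgebra H) (x y : G)
    (X : vnTensor N M) (u v : H) :
    ⟪u, (sliceL N M x y X : H →L[ℂ] H) v⟫_ℂ =
      ⟪htmul x u, (X : HTensor G H →L[ℂ] HTensor G H) (htmul y v)⟫_ℂ := by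
  simp [sliceL, contractL, ContinuousLinearMap.adjoint_inner_right]

theorem inner_sliceR (M : VonNeumannAlgebra H) (N : VonNeumannAlgebra G) (x y : G)
    (X : vnTensor M N) (u v : H) :
    ⟪u, (sliceR M N x y X : H →L[ℂ] H) v⟫_ℂ =
      ⟪htmul u x, (X : HTensor H G →L[ℂ] HTensor H G) (htmul v y)⟫_ℂ := by
  simp [sliceR, contractR, ContinuousLinearMap.adjoint_inner_right]

end VonNeumann

section Maps

variable {H : Type*} [NormedAddCommGroup H] [InnerProductSpace ℂ H] [CompleteSpace H]
variable {K : Type*} [NormedAddCommGroup K] [InnerProductSpace ℂ K] [CompleteSpace K]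

/-- The von Neumann algebra `M_n(ℂ) ⊗̄ M`, acting on `ℂⁿ ⊗ H`. -/
abbrev matAlg (n : ℕ) (M : VonNeumannAlgebra H) :
    VonNeumannAlgebra (HTensor (EuclideanSpace ℂ (Fin n)) H) :=
  vnTensor (fullVN (EuclideanSpace ℂ (Fin n))) M

/-- The matrix unit `e_ij` of `M_n(ℂ) = L(ℂⁿ)`, sending `e_j` to `e_i`. -/
def matUnit {n : ℕ} (i j : Fin n) : EuclideanSpace ℂ (Fin n) →L[ℂ] EuclideanSpace ℂ (Fin n) :=
  InnerProductSpace.rankOne ℂ (EuclideanSpace.single i (1 : ℂ)) (EuclideanSpace.single j (1 : ℂ))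

/-- The map `M → M_n(ℂ) ⊗̄ M`, `A ↦ e_ij ⊗ A`. -/
def matSingle {n : ℕ} (M : VonNeumannAlgebra H) (i j : Fin n) : M →ₗ[ℂ] matAlg n M where
  toFun A := ⟨opTensor (matUnit i j) (A : H →L[ℂ] H), opTensor_mem _ _ (mem_fullVN _) A.2⟩
  map_add' A B := by
    refine Subtype.ext (hext fun x y => hext_inner fun x' y' => ?_)
    simp [inner_add_right, mul_add]
  map_smul' c A := by
    refine Subtype.ext (hext fun x y => hext_inner fun x' y' => ?_)
    simp [inner_smul_right]
    ring

/-- The `(i, j)` entry `X_ij ∈ M` of `X = ∑ e_ij ⊗ X_ij ∈ M_n(ℂ) ⊗̄ M`. -/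
def matEntry {n : ℕ} (M : VonNeumannAlgebra H) (i j : Fin n) : matAlg n M →ₗ[ℂ] M :=
  sliceL _ M (EuclideanSpace.single i (1 : ℂ)) (EuclideanSpace.single j (1 : ℂ))

/-- The map `∑_{k,l,i,j} ε_{kl,ij} ⊗ E k l i j : M_n(ℂ) ⊗̄ M → M_n(ℂ) ⊗̄ N`, where the `ε_{kl,ij}`
are the basis of the space of linear maps on `M_n(ℂ)` with `ε_{kl,ij}(e_ij) = e_kl` and
`ε_{kl,ij}` zero on all other matrix units. -/
def blockMap {n : ℕ} {M : VonNeumannAlgebra H} {N : VonNeumannAlgebra K}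
    (E : Fin n → Fin n → Fin n → Fin n → M →ₗ[ℂ] N) : matAlg n M →ₗ[ℂ] matAlg n N :=
  ∑ k, ∑ l, ∑ i, ∑ j, matSingle N k l ∘ₗ E k l i j ∘ₗ matEntry M i j

/-- The amplification `ι_n ⊗ E : M_n(ℂ) ⊗̄ M → M_n(ℂ) ⊗̄ N`, `∑ e_ij ⊗ X_ij ↦ ∑ e_ij ⊗ E(X_ij)`. -/
def matAmp (n : ℕ) {M : VonNeumannAlgebra H} {N : VonNeumannAlgebra K} (E : M →ₗ[ℂ] N) :
    matAlg n M →ₗ[ℂ] matAlg n N :=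
  ∑ i, ∑ j, matSingle N i j ∘ₗ E ∘ₗ matEntry M i j

/-- Completely positive linear maps. -/
def IsCP {M : VonNeumannAlgebra H} {N : VonNeumannAlgebra K} (E : M →ₗ[ℂ] N) : Prop :=
  ∀ (n : ℕ) (X : matAlg n M), 0 ≤ X → 0 ≤ matAmp n E X

/-- Completely bounded linear maps. -/
def IsCB {M : VonNeumannAlgebra H} {N : VonNeumannAlgebra K} (E : M →ₗ[ℂ] N) : Prop :=
  ∃ C : ℝ, 0 < C ∧ ∀ (n : ℕ) (X : matAlg n M),
    ‖(matAmp n E X).1‖ ≤ C * ‖X.1‖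

/-- Normality: preservation of least upper bounds of increasing sequences of positive elements. -/
def PreservesSup {M : VonNeumannAlgebra H} {N : VonNeumannAlgebra K} (E : M →ₗ[ℂ] N) : Prop :=
  ∀ (A : ℕ → M) (B : M), (∀ k, 0 ≤ A k) → Monotone A → IsLUB (Set.range A) B →
    Monotone (fun k => E (A k)) ∧ IsLUB (Set.range fun k => E (A k)) (E B)

/-- The set `CP(M, N)` of normal completely positive maps. -/
def IsNormalCP {M : VonNeumannAlgebra H} {N : VonNeumannAlgebra K} (E : M →ₗ[ℂ] N) : Prop :=
  IsCP E ∧ PreservesSup E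

/-- The set `CP₁(M, N)` of quantum channels. -/
def IsChannel {M : VonNeumannAlgebra H} {N : VonNeumannAlgebra K} (E : M →ₗ[ℂ] N) : Prop :=
  IsNormalCP E ∧ E 1 = 1

/-- The functional `A ↦ ∑ₙ ⟪x n, A (y n)⟫` on `L(H)`, for square-summable sequences `x`, `y`. -/
def normalFunctional (x y : lp (fun _ : ℕ => H) 2) (A : H →L[ℂ] H) : ℂ :=
  ∑' n, @inner ℂ H _ (x n) (A (y n))

/-- The weak* topology on `L(H)`, i.e. the coarsest topology for which
the functionals `A ↦ ∑ₙ ⟪x n, A (y n)⟫` are continuous. -/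
@[reducible] def weakStar (H : Type*) [NormedAddCommGroup H] [InnerProductSpace ℂ H] [CompleteSpace H] :
    TopologicalSpace (H →L[ℂ] H) :=
  ⨅ x : lp (fun _ : ℕ => H) 2, ⨅ y : lp (fun _ : ℕ => H) 2,
    TopologicalSpace.induced (normalFunctional x y) inferInstance

/-- The weak* topology on a von Neumann algebra. -/
@[reducible] def weakStarOn (M : VonNeumannAlgebra H) : TopologicalSpace M :=
  (weakStar H).induced Subtype.val

theorem summable_normalFunctional {H : Type*} [NormedAddCommGroup H] [InnerProductSpace ℂ H]
    (x y : lp (fun _ : ℕ => H) 2) (A : H →L[ℂ] H) :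
    Summable fun n => @inner ℂ H _ (x n) (A (y n)) := by
  have h := lp.summable_mul (p := 2) (q := 2) (by simpa using Real.HolderConjugate.two_two) x y
  refine Summable.of_norm_bounded (h.mul_left ‖A‖) fun n => ?_
  calc ‖@inner ℂ H _ (x n) (A (y n))‖ ≤ ‖x n‖ * ‖A (y n)‖ := norm_inner_le_norm _ _
    _ ≤ ‖x n‖ * (‖A‖ * ‖y n‖) := by gcongr; exact A.le_opNorm _
    _ = ‖A‖ * (‖x n‖ * ‖y n‖) := by ring

theorem normalFunctional_add {H : Type*} [NormedAddCommGroup H] [InnerProductSpace ℂ H]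
    (x y : lp (fun _ : ℕ => H) 2) (A B : H →L[ℂ] H) :
    normalFunctional x y (A + B) = normalFunctional x y A + normalFunctional x y B := by
  unfold normalFunctional
  rw [← (summable_normalFunctional x y A).tsum_add (summable_normalFunctional x y B)]
  simp

theorem continuous_weakStarOn_iff {T : Type*} [TopologicalSpace T] {M : VonNeumannAlgebra H}
    {f : T → M} : @Continuous T M _ (weakStarOn M) f ↔
      ∀ x y, Continuous fun t => normalFunctional x y (f t : H →L[ℂ] H) := by
  rw [weakStarOn, continuous_induced_rng, weakStar]
  simp only [continuous_iInf_rng, continuous_induced_rng]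
  rfl

/-- The linear space `CB(M, N)` of weak*-continuous completely bounded maps. -/
def CB (M : VonNeumannAlgebra H) (N : VonNeumannAlgebra K) : Submodule ℂ (M →ₗ[ℂ] N) where
  carrier := {E | @Continuous M N (weakStarOn M) (weakStarOn N) E ∧ IsCB E}
  zero_mem' := by
    let _ := weakStarOn M
    refine ⟨continuous_weakStarOn_iff.2 fun x y => ?_, 1, one_pos, fun n X => ?_⟩
    · simpa [normalFunctional] using continuous_const
    · simp [matAmp]
  add_mem' := by
    let _ := weakStarOn M
    rintro E F ⟨hE, C, hC, hE'⟩ ⟨hF, D, hD, hF'⟩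
    refine ⟨continuous_weakStarOn_iff.2 fun x y => ?_, C + D, add_pos hC hD, fun n X => ?_⟩
    · refine ((continuous_weakStarOn_iff.1 hE x y).add
        (continuous_weakStarOn_iff.1 hF x y)).congr fun A => ?_
      exact (normalFunctional_add x y _ _).symm
    · have : matAmp n (E + F) X = matAmp n E X + matAmp n F X := by
        simp [matAmp, Finset.sum_add_distrib]
      rw [this, add_mul]
      exact (norm_add_le _ _).trans (add_le_add (hE' n X) (hF' n X))
  smul_mem' := by
    let _ := weakStarOn M
    rintro c E ⟨hE, C, hC, hE'⟩
    refine ⟨continuous_weakStarOn_iff.2 fun x y => ?_, ‖c‖ * C + 1, by positivity, fun n X => ?_⟩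
    · refine ((continuous_weakStarOn_iff.1 hE x y).const_smul c).congr fun A => ?_
      simp [normalFunctional, tsum_mul_left]
    · have : matAmp n (c • E) X = c • matAmp n E X := by
        simp [matAmp, Finset.smul_sum]
      rw [this]
      calc ‖c • (matAmp n E X).1‖
          = ‖c‖ * ‖(matAmp n E X).1‖ :=
            norm_smul _ _
        _ ≤ ‖c‖ * (C * ‖X.1‖) := by
            gcongr; exact hE' n X
        _ ≤ _ := by rw [← mul_assoc]; gcongr; exact le_add_of_nonneg_right zero_le_one

/-- The relation `E k ⇑ F`: the sequence `E k` in `CP(M, N)` is increasing and bounded for the order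
given by the cone `CP(M, N)`, and `F ∈ CP(M, N)` is its pointwise weak* limit. -/
def CPTendsto {M : VonNeumannAlgebra H} {N : VonNeumannAlgebra K}
    (E : ℕ → M →ₗ[ℂ] N) (F : M →ₗ[ℂ] N) : Prop :=
  (∀ k, IsNormalCP (E k)) ∧ IsNormalCP F ∧
  (∀ k l, k ≤ l → IsNormalCP (E l - E k)) ∧
  (∃ B : M →ₗ[ℂ] N, IsNormalCP B ∧ ∀ k, IsNormalCP (B - E k)) ∧
  ∀ A : M, Filter.Tendsto (fun k => E k A) Filter.atTop (@nhds N (weakStarOn N) (F A))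

end Maps

section Amplification

variable {H : Type*} [NormedAddCommGroup H] [InnerProductSpace ℂ H] [CompleteSpace H]
variable {K : Type*} [NormedAddCommGroup K] [InnerProductSpace ℂ K] [CompleteSpace K]
variable {V : Type*} [NormedAddCommGroup V] [InnerProductSpace ℂ V] [CompleteSpace V]
variable {M : VonNeumannAlgebra H} {N : VonNeumannAlgebra K}

theorem inner_single_one {n : ℕ} (i j : Fin n) :
    ⟪EuclideanSpace.single i (1 : ℂ), EuclideanSpace.single j (1 : ℂ)⟫_ℂ =
      if i = j then 1 else 0 := by
  simp [EuclideanSpace.inner_single_left, PiLp.single_apply]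

theorem matEntry_matSingle {n : ℕ} (i j k l : Fin n) (A : M) :
    matEntry M i j (matSingle M k l A) = if i = k ∧ j = l then A else 0 := by
  refine Subtype.ext ?_
  ext w
  refine ext_inner_left ℂ fun v => ?_
  rw [matEntry, inner_sliceL]
  by_cases hi : i = k <;> by_cases hj : j = l <;>
    simp [matSingle, matUnit, hi, hj, inner_single_one, eq_comm (a := l) (b := j)]

theorem inner_matAmp {n : ℕ} (E : M →ₗ[ℂ] N) (X : matAlg n M) (u u' : Fin n → K) :
    ⟪∑ i, htmul (EuclideanSpace.single i (1 : ℂ)) (u i),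
      (matAmp n E X).1 (∑ j, htmul (EuclideanSpace.single j (1 : ℂ)) (u' j))⟫_ℂ =
    ∑ i, ∑ j, ⟪u i, (E (matEntry M i j X)).1 (u' j)⟫_ℂ := by
  have : (matAmp n E X).1 =
      ∑ i, ∑ j, opTensor (matUnit i j) (E (matEntry M i j X)).1 := by
    simp [matAmp, matSingle]
  rw [this]
  have h : ∀ a b i j : Fin n, ⟪htmul (EuclideanSpace.single a (1 : ℂ)) (u a),
      opTensor (matUnit i j) (E (matEntry M i j X)).1
        (htmul (EuclideanSpace.single b (1 : ℂ)) (u' b))⟫_ℂ =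
      if a = i then if j = b then ⟪u a, (E (matEntry M i j X)).1 (u' b)⟫_ℂ else 0 else 0 := by
    intro a b i j
    by_cases h1 : a = i <;> by_cases h2 : j = b <;>
      simp [matUnit, inner_single_one, h1, h2]
  simp only [sum_apply, map_sum, sum_inner, inner_sum, h]
  simp only [Finset.mem_univ, if_true, Finset.sum_ite_eq']
  rw [Finset.sum_comm]

theorem norm_sum_htmul {K : Type*} [NormedAddCommGroup K] [InnerProductSpace ℂ K]
    {V : Type*} [NormedAddCommGroup V] [InnerProductSpace ℂ V] {n : ℕ} {e : Fin n → V} (he : Orthonormal ℂ e) (u : Fin n → K) :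
    ‖∑ i, u i ⊗ₜ[ℂ] e i‖ =
      ‖∑ i, htmul (EuclideanSpace.single i (1 : ℂ)) (u i)‖ := by
  have h : ∀ (a b : ℝ), 0 ≤ a → 0 ≤ b → ((a : ℂ)) ^ 2 = (b : ℂ) ^ 2 → a = b := by
    intro a b ha hb hab
    exact (sq_eq_sq₀ ha hb).1 (by exact_mod_cast hab)
  refine h _ _ (norm_nonneg _) (norm_nonneg _) ?_
  have h1 := inner_self_eq_norm_sq_to_K (𝕜 := ℂ) (∑ i, u i ⊗ₜ[ℂ] e i)
  have h2 := inner_self_eq_norm_sq_to_K (𝕜 := ℂ)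
    (∑ i, htmul (EuclideanSpace.single i (1 : ℂ)) (u i))
  refine h1.symm.trans (Eq.trans ?_ h2)
  simp only [sum_inner, inner_sum, inner_htmul, TensorProduct.inner_tmul,
    orthonormal_iff_ite.1 he, inner_single_one, mul_comm]

/-- Every pair of algebraic tensors can be expanded along a common finite orthonormal family. -/
theorem exists_orthonormal_expansion {K : Type*} [NormedAddCommGroup K] [InnerProductSpace ℂ K]
    {V : Type*} [NormedAddCommGroup V] [InnerProductSpace ℂ V] (z z' : K ⊗[ℂ] V) :
    ∃ (n : ℕ) (e : Fin n → V) (u u' : Fin n → K), Orthonormal ℂ e ∧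
      z = ∑ i, u i ⊗ₜ[ℂ] e i ∧ z' = ∑ i, u' i ⊗ₜ[ℂ] e i := by
  obtain ⟨E', F', iE', iF', hz⟩ :=
    TensorProduct.exists_finite_submodule_of_setFinite {z, z'} (Set.toFinite _)
  let f := stdOrthonormalBasis ℂ F'
  have key : ∀ y : E' ⊗[ℂ] F', ∃ u : Fin (Module.finrank ℂ F') → K,
      TensorProduct.mapIncl E' F' y = ∑ i, u i ⊗ₜ[ℂ] (f i : V) := by
    intro y
    induction y with
    | zero => exact ⟨0, by simp⟩
    | tmul x v =>
      refine ⟨fun i => ⟪f i, v⟫_ℂ • (x : K), ?_⟩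
      have hv : (v : V) = ∑ i, ⟪f i, v⟫_ℂ • (f i : V) := by
        conv_lhs => rw [← f.sum_repr' v]
        simp
      simp only [TensorProduct.mapIncl, TensorProduct.map_tmul, Submodule.subtype_apply]
      rw [hv, TensorProduct.tmul_sum]
      simp [TensorProduct.smul_tmul]
    | add a b ha hb =>
      obtain ⟨u, hu⟩ := ha
      obtain ⟨u', hu'⟩ := hb
      exact ⟨u + u', by simp [hu, hu', TensorProduct.add_tmul, Finset.sum_add_distrib]⟩
  obtain ⟨y, hy⟩ := hz (Set.mem_insert _ _)
  obtain ⟨y', hy'⟩ := hz (Set.mem_insert_of_mem _ rfl)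
  obtain ⟨u, hu⟩ := key y
  obtain ⟨u', hu'⟩ := key y'
  exact ⟨_, fun i => (f i : V), u, u',
    f.orthonormal.comp_linearIsometry F'.subtypeₗᵢ, hy ▸ hu, hy' ▸ hu'⟩

/-- Compressing `X ∈ M ⊗̄ L(V)` to a finite orthonormal family gives a matrix over `M`
of norm at most `‖X‖`. -/
theorem exists_compression {n : ℕ} {e : Fin n → V} (he : Orthonormal ℂ e)
    (X : vnTensor M (fullVN V)) :
    ∃ Y : matAlg n M, ‖Y.1‖ ≤ ‖X.1‖ ∧
      ∀ i j, matEntry M i j Y = sliceR M (fullVN V) (e i) (e j) X := by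
  refine ⟨∑ k, ∑ l, matSingle M k l (sliceR M (fullVN V) (e k) (e l) X), ?_, fun i j => ?_⟩
  · let b := EuclideanSpace.basisFun (Fin n) ℂ
    let f : EuclideanSpace ℂ (Fin n) →ₗᵢ[ℂ] V :=
      (b.toBasis.constr ℂ e).isometryOfOrthonormal (v := b.toBasis)
        (by simp)
        (by
          have : ⇑(b.toBasis.constr ℂ e) ∘ ⇑b.toBasis = e := by
            ext i; simp only [Function.comp, Module.Basis.constr_basis]
          rw [this]; exact he)
    have hf : ∀ x, f x = ∑ i, x i • e i := fun x => by
      change b.toBasis.constr ℂ e x = _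
      rw [Module.Basis.constr_apply_fintype]
      simp [b]
    let J₀ : EuclideanSpace ℂ (Fin n) ⊗[ℂ] H →ₗᵢ[ℂ] H ⊗[ℂ] V :=
      (TensorProduct.commIsometry ℂ V H).toLinearIsometry.comp
        (TensorProduct.mapIsometry f LinearIsometry.id)
    let J : HTensor (EuclideanSpace ℂ (Fin n)) H →L[ℂ] HTensor H V :=
      J₀.toContinuousLinearMap.completion
    have hJ : ∀ x h, J (htmul x h) = htmul h (f x) := fun x h => by
      simp [J, J₀, htmul]
    have hJn : ‖J‖ ≤ 1 := by
      refine ContinuousLinearMap.opNorm_le_bound _ zero_le_one fun z => ?_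
      refine UniformSpace.Completion.induction_on z
        (isClosed_le (by fun_prop) (by fun_prop)) fun w => ?_
      simp [J]
    have hY : (∑ k, ∑ l, matSingle M k l (sliceR M (fullVN V) (e k) (e l) X)).1 =
        (ContinuousLinearMap.adjoint J).comp (X.1.comp J) := by
      refine hext fun x y => hext_inner fun x' y' => ?_
      have h2 : ∀ k l : Fin n, ⟪htmul x' y',
          opTensor (matUnit k l) (sliceR M (fullVN V) (e k) (e l) X).1 (htmul x y)⟫_ℂ =
          (starRingEnd ℂ (x' k)) * (x l) * ⟪htmul y' (e k), X.1 (htmul y (e l))⟫_ℂ := by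
        intro k l
        rw [opTensor_htmul, inner_htmul, inner_sliceR]
        simp only [matUnit, InnerProductSpace.rankOne_apply, inner_smul_right,
          EuclideanSpace.inner_single_left, EuclideanSpace.inner_single_right]
        simp only [map_one, one_mul]
        ring
      have hR : ∀ (h : H) (x : EuclideanSpace ℂ (Fin n)),
          htmul h (f x) = ∑ i, x i • htmul h (e i) := by
        intro h x
        rw [← insL_apply, hf]
        simp
      simp only [ContinuousLinearMap.comp_apply, ContinuousLinearMap.adjoint_inner_right, hJ, hR]
      simp only [map_sum, map_smul, sum_inner, inner_sum, inner_smul_left, inner_smul_right]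
      have h3 : (∑ k, ∑ l, matSingle M k l (sliceR M (fullVN V) (e k) (e l) X)).1 =
          ∑ k, ∑ l, opTensor (matUnit k l) (sliceR M (fullVN V) (e k) (e l) X).1 := by
        simp [matSingle]
      rw [h3]
      simp only [sum_apply, inner_sum, h2]
      rw [Finset.sum_comm]
      refine Finset.sum_congr rfl fun l _ => ?_
      rw [Finset.mul_sum]
      refine Finset.sum_congr rfl fun k _ => ?_
      ring
    rw [hY]
    calc _ ≤ ‖ContinuousLinearMap.adjoint J‖ * (‖X.1‖ * ‖J‖) :=
          (ContinuousLinearMap.opNorm_comp_le _ _).trans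
            (by gcongr; exact ContinuousLinearMap.opNorm_comp_le _ _)
      _ ≤ 1 * (‖X.1‖ * 1) := by
          rw [LinearIsometryEquiv.norm_map]
          gcongr
      _ = ‖X.1‖ := by ring
  · simp only [map_sum, matEntry_matSingle]
    simp [ite_and]

theorem sliceR_add_left (N : VonNeumannAlgebra V) (x x' y : V) (X : vnTensor M N) :
    sliceR M N (x + x') y X = sliceR M N x y X + sliceR M N x' y X := by
  refine Subtype.ext (ContinuousLinearMap.ext fun w => ext_inner_left ℂ fun v => ?_)
  simp [inner_sliceR, inner_add_right, ← insL_apply, inner_add_left]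

theorem sliceR_add_right (N : VonNeumannAlgebra V) (x y y' : V) (X : vnTensor M N) :
    sliceR M N x (y + y') X = sliceR M N x y X + sliceR M N x y' X := by
  refine Subtype.ext (ContinuousLinearMap.ext fun w => ext_inner_left ℂ fun v => ?_)
  simp [inner_sliceR, inner_add_right, ← insL_apply]

theorem sliceR_smul_left (N : VonNeumannAlgebra V) (c : ℂ) (x y : V) (X : vnTensor M N) :
    sliceR M N (c • x) y X = (starRingEnd ℂ c) • sliceR M N x y X := by
  refine Subtype.ext (ContinuousLinearMap.ext fun w => ext_inner_left ℂ fun v => ?_)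
  have := inner_sliceR M N x y X v w
  rw [inner_sliceR]
  simp [← insL_apply, inner_smul_left, inner_smul_right]
  simp [this]

theorem sliceR_smul_right (N : VonNeumannAlgebra V) (c : ℂ) (x y : V) (X : vnTensor M N) :
    sliceR M N x (c • y) X = c • sliceR M N x y X := by
  refine Subtype.ext (ContinuousLinearMap.ext fun w => ext_inner_left ℂ fun v => ?_)
  have := inner_sliceR M N x y X v w
  rw [inner_sliceR]
  simp [← insL_apply, inner_smul_right]
  simp [this]

/-- The sesquilinear form of the amplification `E ⊗ ι_V` on algebraic tensors. -/
def ampForm (E : M →ₗ[ℂ] fullVN K) (X : vnTensor M (fullVN V)) :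
    K ⊗[ℂ] V →ₗ⋆[ℂ] K ⊗[ℂ] V →ₗ[ℂ] ℂ :=
  TensorProduct.lift (LinearMap.mk₂'ₛₗ (starRingEnd ℂ) (starRingEnd ℂ)
    (fun u' v' => TensorProduct.lift (LinearMap.mk₂ ℂ
      (fun u v => ⟪(E (sliceR M (fullVN V) v v' X)).1 u', u⟫_ℂ)
      (fun _ _ _ => inner_add_right _ _ _)
      (fun _ _ _ => inner_smul_right _ _ _)
      (fun _ _ _ => by simp [sliceR_add_left])
      (fun _ _ _ => by simp [sliceR_smul_left, mul_comm])))
    (fun _ _ _ => by ext; simp)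
    (fun _ _ _ => by ext; simp [mul_comm])
    (fun _ _ _ => by ext; simp [sliceR_add_right])
    (fun _ _ _ => by ext; simp [sliceR_smul_right, mul_comm]))

theorem ampForm_tmul (E : M →ₗ[ℂ] fullVN K) (X : vnTensor M (fullVN V)) (u u' : K) (v v' : V) :
    ampForm E X (u' ⊗ₜ v') (u ⊗ₜ v) = ⟪(E (sliceR M (fullVN V) v v' X)).1 u', u⟫_ℂ := by
  simp [ampForm]

theorem ampForm_bound {E : M →ₗ[ℂ] fullVN K} {C : ℝ}
    (hC : ∀ (n : ℕ) (X : matAlg n M), ‖(matAmp n E X).1‖ ≤ C * ‖X.1‖)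
    (X : vnTensor M (fullVN V)) (hC0 : 0 < C) (z' z : K ⊗[ℂ] V) :
    ‖ampForm E X z' z‖ ≤ C * ‖X.1‖ * ‖z'‖ * ‖z‖ := by
  obtain ⟨n, e, u, u', he, rfl, rfl⟩ := exists_orthonormal_expansion z z'
  obtain ⟨Y, hY, hYe⟩ := exists_compression he X
  have h1 : ampForm E X (∑ i, u' i ⊗ₜ[ℂ] e i) (∑ i, u i ⊗ₜ[ℂ] e i) =
      starRingEnd ℂ (∑ i, ∑ j, ⟪u i, (E (matEntry M i j Y)).1 (u' j)⟫_ℂ) := by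
    simp only [map_sum, LinearMap.sum_apply, ampForm_tmul, hYe, inner_conj_symm]
  rw [h1, ← inner_matAmp, RCLike.norm_conj, norm_sum_htmul he, norm_sum_htmul he]
  calc _ ≤ ‖∑ i, htmul (EuclideanSpace.single i (1 : ℂ)) (u i)‖ *
        (‖(matAmp n E Y).1‖ * ‖∑ i, htmul (EuclideanSpace.single i (1 : ℂ)) (u' i)‖) :=
        (norm_inner_le_norm _ _).trans (by gcongr; exact ContinuousLinearMap.le_opNorm _ _)
    _ ≤ ‖∑ i, htmul (EuclideanSpace.single i (1 : ℂ)) (u i)‖ *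
        ((C * ‖X.1‖) * ‖∑ i, htmul (EuclideanSpace.single i (1 : ℂ)) (u' i)‖) := by
        gcongr
        exact (hC n Y).trans (by gcongr)
    _ = _ := by ring

/-- For completely bounded `E : M → L(K)` and `X ∈ M ⊗̄ L(V)` there is a bounded operator
`(E ⊗ ι_V)(X)` on `K ⊗ V` whose right slices are the images under `E` of those of `X`. -/
theorem exists_ampl {E : M →ₗ[ℂ] fullVN K} (hE : IsCB E) (X : vnTensor M (fullVN V)) :
    ∃ T : HTensor K V →L[ℂ] HTensor K V, ∀ (u u' : K) (v v' : V),
      ⟪htmul u v, T (htmul u' v')⟫_ℂ = ⟪u, (E (sliceR M (fullVN V) v v' X)).1 u'⟫_ℂ := by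
  obtain ⟨C, hC0, hC⟩ := hE
  have hb := ampForm_bound hC X hC0
  let φ : K ⊗[ℂ] V → StrongDual ℂ (HTensor K V) := fun z' =>
    ((ampForm E X z').mkContinuous _ (hb z')).fromCompletion
  have hφ : ∀ z' (z : K ⊗[ℂ] V), φ z' (z : HTensor K V) = ampForm E X z' z := fun z' z => by simp [φ]
  let T₀ : K ⊗[ℂ] V → HTensor K V := fun z' => (InnerProductSpace.toDual ℂ _).symm (φ z')
  have hT₀ : ∀ z' (z : K ⊗[ℂ] V), ⟪T₀ z', (z : HTensor K V)⟫_ℂ = ampForm E X z' z := fun z' z => by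
    rw [InnerProductSpace.toDual_symm_apply, hφ]
  have hext' : ∀ a b : HTensor K V,
      (∀ z : K ⊗[ℂ] V, ⟪a, (z : HTensor K V)⟫_ℂ = ⟪b, (z : HTensor K V)⟫_ℂ) → a = b := by
    intro a b h
    refine hext_inner fun x y => ?_
    rw [← inner_conj_symm, ← inner_conj_symm _ b]
    exact congrArg _ (h _)
  let T₁ : K ⊗[ℂ] V →ₗ[ℂ] HTensor K V :=
    { toFun := T₀
      map_add' := fun a b => hext' _ _ fun z => by
        simp [inner_add_left, hT₀]
      map_smul' := fun c a => hext' _ _ fun z => by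
        simp [inner_smul_left, hT₀] }
  have hT₁ : ∀ z', ‖T₁ z'‖ ≤ C * ‖X.1‖ * ‖z'‖ := fun z' => by
    change ‖(InnerProductSpace.toDual ℂ _).symm (φ z')‖ ≤ _
    rw [LinearIsometryEquiv.norm_map]
    refine ContinuousLinearMap.opNorm_le_bound _ (by positivity) fun w => ?_
    refine UniformSpace.Completion.induction_on w
      (isClosed_le (by fun_prop) (by fun_prop)) fun z => ?_
    rw [hφ, UniformSpace.Completion.norm_coe]
    exact hb z' z
  refine ⟨(T₁.mkContinuous _ hT₁).fromCompletion, fun u u' v v' => ?_⟩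
  have h := hT₀ (u' ⊗ₜ v') (u ⊗ₜ v)
  rw [ampForm_tmul] at h
  have h' := congrArg (starRingEnd ℂ) h
  rw [inner_conj_symm, inner_conj_symm] at h'
  simpa [htmul, T₁] using h'

/-- The amplification `(E ⊗ ι_V)(X)`, for `E ∈ CB(M, L(K))` and `X ∈ M ⊗̄ L(V)`: the bounded
operator on `K ⊗ V` whose right slices are the images under `E` of the right slices of `X`.
On elementary tensors it is given by `A ⊗ B ↦ E(A) ⊗ B` (see `ampl_opTensor`); as all slices are
weak*-continuous in `X`, it is the unique weak*-continuous map with this property. -/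
def ampl (E : CB M (fullVN K)) (X : vnTensor M (fullVN V)) : HTensor K V →L[ℂ] HTensor K V :=
  (exists_ampl E.2.2 X).choose

theorem inner_ampl (E : CB M (fullVN K)) (X : vnTensor M (fullVN V)) (u u' : K) (v v' : V) :
    ⟪htmul u v, ampl E X (htmul u' v')⟫_ℂ = ⟪u, (E.1 (sliceR M (fullVN V) v v' X)).1 u'⟫_ℂ :=
  (exists_ampl E.2.2 X).choose_spec u u' v v'

/-- `(E ⊗ ι_V)(A ⊗ B) = E(A) ⊗ B`. -/
theorem ampl_opTensor (E : CB M (fullVN K)) (A : M) (B : V →L[ℂ] V) :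
    ampl E ⟨opTensor A.1 B, opTensor_mem M (fullVN V) A.2 (mem_fullVN B)⟩ =
      opTensor (E.1 A).1 B := by
  have h : ∀ v v', sliceR M (fullVN V) v v'
      ⟨opTensor A.1 B, opTensor_mem M (fullVN V) A.2 (mem_fullVN B)⟩ = ⟪v, B v'⟫_ℂ • A := by
    intro v v'
    refine Subtype.ext (ContinuousLinearMap.ext fun w => ext_inner_left ℂ fun u => ?_)
    rw [inner_sliceR]
    simp [inner_smul_right, mul_comm]
  refine hext fun x y => hext_inner fun x' y' => ?_
  rw [inner_ampl, h]
  simp [mul_comm]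

end Amplification

section Supermaps

variable {H₁ : Type*} [NormedAddCommGroup H₁] [InnerProductSpace ℂ H₁] [CompleteSpace H₁]
variable {H₂ : Type*} [NormedAddCommGroup H₂] [InnerProductSpace ℂ H₂] [CompleteSpace H₂]
variable {K₁ : Type*} [NormedAddCommGroup K₁] [InnerProductSpace ℂ K₁] [CompleteSpace K₁]
variable {K₂ : Type*} [NormedAddCommGroup K₂] [InnerProductSpace ℂ K₂] [CompleteSpace K₂]
variable {M₁ : VonNeumannAlgebra H₁} {M₂ : VonNeumannAlgebra H₂}
variable {N₁ : VonNeumannAlgebra K₁} {N₂ : VonNeumannAlgebra K₂}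

/-- Complete positivity of `S : CB(M₁, N₁) → CB(M₂, N₂)`: every map `I_n ⊗ S` is positive. Here
`CB(M_n(ℂ) ⊗̄ M, M_n(ℂ) ⊗̄ N)` is the algebraic tensor product of `CB(M_n(ℂ), M_n(ℂ))` with
`CB(M, N)`, so its elements are the maps `∑ ε_{kl,ij} ⊗ E k l i j` with `E k l i j ∈ CB(M, N)`, and
`I_n ⊗ S` sends such a map to `∑ ε_{kl,ij} ⊗ S (E k l i j)`. -/
def IsCPSupermap (S : CB M₁ N₁ →ₗ[ℂ] CB M₂ N₂) : Prop :=
  ∀ (n : ℕ) (E : Fin n → Fin n → Fin n → Fin n → CB M₁ N₁),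
    IsNormalCP (blockMap fun k l i j => (E k l i j).1) →
      IsNormalCP (blockMap fun k l i j => (S (E k l i j)).1)

/-- Normality of `S : CB(M₁, N₁) → CB(M₂, N₂)`. -/
def IsNormalSupermap (S : CB M₁ N₁ →ₗ[ℂ] CB M₂ N₂) : Prop :=
  ∀ (E : ℕ → CB M₁ N₁) (F : CB M₁ N₁),
    CPTendsto (fun k => (E k).1) F.1 → CPTendsto (fun k => (S (E k)).1) (S F).1

/-- Deterministic supermaps: linear normal completely positive maps
`S : CB(M₁, N₁) → CB(M₂, N₂)` that send quantum channels to quantum channels. -/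
def IsDeterministicSupermap (S : CB M₁ N₁ →ₗ[ℂ] CB M₂ N₂) : Prop :=
  IsCPSupermap S ∧ IsNormalSupermap S ∧ ∀ E : CB M₁ N₁, IsChannel E.1 → IsChannel (S E).1

variable {𝒱 : Type*} [NormedAddCommGroup 𝒱] [InnerProductSpace ℂ 𝒱] [CompleteSpace 𝒱]

/-- `(𝒱, V, F)` is a dilation of `S`: `F` is a quantum channel from `M₂` to `M₁ ⊗̄ L(𝒱)`, and
`[S(E)](A) = V* [(E ⊗ ι_𝒱)(F(A))] V` for all `E ∈ CB(M₁, L(K₁))` and `A ∈ M₂`. -/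
def IsDilation (S : CB M₁ (fullVN K₁) →ₗ[ℂ] CB M₂ (fullVN K₂))
    (V : K₂ →ₗᵢ[ℂ] HTensor K₁ 𝒱) (F : M₂ →ₗ[ℂ] vnTensor M₁ (fullVN 𝒱)) : Prop :=
  IsChannel F ∧ ∀ (E : CB M₁ (fullVN K₁)) (A : M₂),
    ((S E).1 A).1 = (ContinuousLinearMap.adjoint V.toContinuousLinearMap).comp
      ((ampl E (F A)).comp V.toContinuousLinearMap)

/-- Minimality of a dilation `(𝒱, V, F)`:
`𝒱` is the closed linear span of the vectors `(u* ⊗ I) V v` with `u ∈ K₁` and `v ∈ K₂`. -/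
def IsMinimal (V : K₂ →ₗᵢ[ℂ] HTensor K₁ 𝒱) : Prop :=
  (Submodule.span ℂ {w : 𝒱 | ∃ (u : K₁) (v : K₂), w = contractL 𝒱 u (V v)}).topologicalClosure = ⊤

end Supermaps

end QSupermap

end

open QSupermap

/-!
A dilation is probed with the elementary maps `E = ⟪h, · h'⟫ |u⟩⟨u'|`, where `h`, `h'` lie in `H₁`
and `u`, `u'` in `K₁`. Such an `E` is weak*-continuous and completely bounded (`elemMap`):
its matrix amplification is a compression by operators whose norms do not depend on the size of
the matrices (`matAmp_elemMapₗ`). Moreover `(E ⊗ ι)(X) = |u⟩⟨u'| ⊗ B`, where `B` is the left slice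
of `X` at `h`, `h'` (`ampl_elemMap`). Writing `a (u, v) = (u* ⊗ I) V v`, the dilation formula
therefore becomes
`⟪h ⊗ a (u, v), F A (h' ⊗ a (u', v'))⟫ = ⟪v, [S E](A) v'⟫` (`IsDilation.inner_slice`),
whose right side depends on `S` only. So the left sides for two dilations of `S` coincide.

For `A = 1` and `h = h'` a unit vector, this says that the families `a` and `b` of the two dilations
have the same Gram matrix. As `a` has dense span by minimality, there is an isometry `W` with
`W (a p) = b p` (`exists_linearIsometry_of_inner_eq`). These equations are equivalent to
`V' = (I ⊗ W) V` (`eq_opTensor_id_comp_iff`), and they determine `W`. For general `A`, the same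
identity says that the slices of `F A` and of `(I ⊗ W*) F' A (I ⊗ W)` have the same matrix elements
along `a`, so that the two operators agree (`ext_inner_of_dense_span`). If the second dilation is
minimal too, the range of `W` is closed and contains the family `b`, which has dense span;
hence `W` is onto and the last formula can be inverted.
-/

noncomputable section

namespace QSupermap

/-! ### Norms of insertions and contractions -/

section ElementaryTensorNorms

variable {G : Type*} [NormedAddCommGroup G] [InnerProductSpace ℂ G]
variable {H : Type*} [NormedAddCommGroup H] [InnerProductSpace ℂ H]

theorem norm_htmul (x : G) (y : H) : ‖htmul x y‖ = ‖x‖ * ‖y‖ := by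
  rw [htmul, UniformSpace.Completion.norm_coe, TensorProduct.norm_tmul]

theorem norm_insR_le (y : H) : ‖insR G y‖ ≤ ‖y‖ :=
  ContinuousLinearMap.opNorm_le_bound _ (norm_nonneg _) fun x => by
    rw [insR_apply, norm_htmul, mul_comm]

theorem norm_contractR_le [CompleteSpace G] (y : H) : ‖contractR G y‖ ≤ ‖y‖ := by
  rw [contractR, LinearIsometryEquiv.norm_map]
  exact norm_insR_le y

end ElementaryTensorNorms

/-! ### Elementary completely bounded maps -/

section ElementaryMaps

variable {H : Type*} [NormedAddCommGroup H] [InnerProductSpace ℂ H] [CompleteSpace H]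
variable {K : Type*} [NormedAddCommGroup K] [InnerProductSpace ℂ K] [CompleteSpace K]
variable {V : Type*} [NormedAddCommGroup V] [InnerProductSpace ℂ V] [CompleteSpace V]

/-- The elementary map `A ↦ ⟪h, A h'⟫ |u⟩⟨u'|` from `M` to `L(K)`, as a linear map. -/
def elemMapₗ (M : VonNeumannAlgebra H) (h h' : H) (u u' : K) : M →ₗ[ℂ] fullVN K where
  toFun A := ⟨⟪h, (A : H →L[ℂ] H) h'⟫_ℂ • InnerProductSpace.rankOne ℂ u u', mem_fullVN _⟩
  map_add' A B := Subtype.ext <| by simp [add_smul]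
  map_smul' c A := Subtype.ext <| by simp [mul_smul]

/-- The amplification of an elementary map to `n × n` matrices is `T ⊗ |u⟩⟨u'|`, where `T ∈ M_n(ℂ)`
is the compression `(I ⊗ h*) X (I ⊗ h')`. In the factored form given here its norm is bounded
independently of `n`. -/
theorem matAmp_elemMapₗ (M : VonNeumannAlgebra H) (h h' : H) (u u' : K) {n : ℕ}
    (X : matAlg n M) :
    (matAmp n (elemMapₗ M h h' u u') X).1 =
      (insR _ u).comp ((contractR _ h).comp (X.1.comp ((insR _ h').comp (contractR _ u')))) := by
  let b := EuclideanSpace.basisFun (Fin n) ℂ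
  let T : EuclideanSpace ℂ (Fin n) →L[ℂ] EuclideanSpace ℂ (Fin n) :=
    (contractR _ h).comp (X.1.comp (insR _ h'))
  have hT : ∀ i j, ⟪h, (matEntry M i j X).1 h'⟫_ℂ = ⟪b i, T (b j)⟫_ℂ := fun i j => by
    rw [matEntry, inner_sliceL]
    simp [T, b, contractR, ContinuousLinearMap.adjoint_inner_right]
  have hA : (matAmp n (elemMapₗ M h h' u u') X).1 = ∑ i, ∑ j,
      opTensor (matUnit i j) (⟪b i, T (b j)⟫_ℂ • InnerProductSpace.rankOne ℂ u u') := by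
    simp [matAmp, matSingle, elemMapₗ, hT]
  refine hext fun x y => hext_inner fun x' y' => ?_
  have h1 : ∀ i j, ⟪htmul x' y', opTensor (matUnit i j)
      (⟪b i, T (b j)⟫_ℂ • InnerProductSpace.rankOne ℂ u u') (htmul x y)⟫_ℂ =
      (⟪u', y⟫_ℂ * ⟪y', u⟫_ℂ) *
        (⟪x', b i⟫_ℂ * (⟪ContinuousLinearMap.adjoint T (b i), b j⟫_ℂ * ⟪b j, x⟫_ℂ)) := by
    intro i j
    rw [ContinuousLinearMap.adjoint_inner_left, opTensor_htmul, inner_htmul, matUnit,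
      InnerProductSpace.rankOne_apply, smul_apply, InnerProductSpace.rankOne_apply]
    simp only [inner_smul_right]
    simp only [b, EuclideanSpace.basisFun_apply]
    ring
  rw [hA]
  -- Two applications of the Parseval identity collapse the sum over matrix units to `⟪x', T x⟫`.
  simp only [sum_apply, inner_sum, h1, ← Finset.mul_sum, b.sum_inner_mul_inner]
  simp only [ContinuousLinearMap.adjoint_inner_left, b.sum_inner_mul_inner]
  have h2 : ⟪htmul x' y', insR _ u (T (⟪u', y⟫_ℂ • x))⟫_ℂ =
      ⟪u', y⟫_ℂ * ⟪y', u⟫_ℂ * ⟪x', T x⟫_ℂ := by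
    rw [insR_apply, inner_htmul, map_smul, inner_smul_right]
    ring
  rw [← h2]
  simp [T]

/-- The elementary map `A ↦ ⟪h, A h'⟫ |u⟩⟨u'|` as an element of `CB(M, L(K))`. -/
def elemMap (M : VonNeumannAlgebra H) (h h' : H) (u u' : K) : CB M (fullVN K) :=
  ⟨elemMapₗ M h h' u u', by
    let _ := weakStarOn M
    constructor
    · refine continuous_weakStarOn_iff.2 fun x y => ?_
      -- Square-summable sequences with one nonzero term give the vector functional `⟪h, · h'⟫`.
      have hc := (continuous_weakStarOn_iff (M := M)).1 continuous_id
        (lp.single 2 0 h) (lp.single 2 0 h')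
      refine (hc.mul_const (normalFunctional x y (InnerProductSpace.rankOne ℂ u u'))).congr
        fun A => ?_
      have h0 : normalFunctional (lp.single 2 0 h) (lp.single 2 0 h') A.1 = ⟪h, A.1 h'⟫_ℂ := by
        rw [normalFunctional, tsum_eq_single 0 fun k hk => by
          rw [lp.single_apply_ne _ _ _ hk, inner_zero_left]]
        simp
      rw [id, h0]
      simp [normalFunctional, elemMapₗ, tsum_mul_left]
    · -- The summand `1` makes the bound positive, as `IsCB` requires, also for zero vectors.
      refine ⟨‖u‖ * (‖h‖ * (‖h'‖ * ‖u'‖)) + 1, by positivity, fun n X => ?_⟩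
      rw [matAmp_elemMapₗ]
      calc _ ≤ ‖u‖ * (‖h‖ * (‖X.1‖ * (‖h'‖ * ‖u'‖))) := by
            grw [ContinuousLinearMap.opNorm_comp_le, ContinuousLinearMap.opNorm_comp_le,
              ContinuousLinearMap.opNorm_comp_le, ContinuousLinearMap.opNorm_comp_le,
              norm_insR_le, norm_insR_le, norm_contractR_le, norm_contractR_le]
        _ = ‖u‖ * (‖h‖ * (‖h'‖ * ‖u'‖)) * ‖X.1‖ := by ring
        _ ≤ _ := by gcongr; exact le_add_of_nonneg_right zero_le_one⟩

/-- For the elementary map `E = ⟪h, · h'⟫ |u⟩⟨u'|`, the amplification `(E ⊗ ι_V)(X)` is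
`|u⟩⟨u'| ⊗ B`, where `B ∈ L(V)` is the left slice of `X` at `h`, `h'`. -/
theorem ampl_elemMap {M : VonNeumannAlgebra H} (h h' : H) (u u' : K)
    (X : vnTensor M (fullVN V)) :
    ampl (elemMap M h h' u u') X =
      (insL V u).comp ((sliceL M (fullVN V) h h' X).1.comp (contractL V u')) := by
  refine hext fun x y => hext_inner fun x' y' => ?_
  rw [inner_ampl]
  simp only [elemMap, elemMapₗ, LinearMap.coe_mk, AddHom.coe_mk, ContinuousLinearMap.comp_apply,
    contractL_htmul, map_smul, insL_apply, inner_smul_right, inner_htmul, inner_sliceL,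
    inner_sliceR, smul_apply, InnerProductSpace.rankOne_apply]
  ring

end ElementaryMaps

/-! ### Isometries from equal Gram matrices -/

section GramIsometry

variable {V : Type*} [NormedAddCommGroup V] [InnerProductSpace ℂ V]
variable {V' : Type*} [NormedAddCommGroup V'] [InnerProductSpace ℂ V'] [CompleteSpace V']

/-- Two families of vectors with the same Gram matrix are related by an isometry, provided that the
first of them has dense span. -/
theorem exists_linearIsometry_of_inner_eq {ι : Type*} (a : ι → V) (b : ι → V')
    (hab : ∀ i j, ⟪a i, a j⟫_ℂ = ⟪b i, b j⟫_ℂ)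
    (ha : (Submodule.span ℂ (Set.range a)).topologicalClosure = ⊤) :
    ∃ W : V →ₗᵢ[ℂ] V', ∀ i, W (a i) = b i := by
  let e := Finsupp.linearCombination ℂ a
  let f := Finsupp.linearCombination ℂ b
  have hdense : DenseRange e := by
    rw [DenseRange, ← LinearMap.coe_range, Finsupp.range_linearCombination]
    exact Submodule.dense_iff_topologicalClosure_eq_top.2 ha
  have hinner : ∀ c d, ⟪f c, f d⟫_ℂ = ⟪e c, e d⟫_ℂ := fun c d => by
    simp only [e, f, Finsupp.linearCombination_apply, Finsupp.sum, sum_inner, inner_sum,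
      inner_smul_left, inner_smul_right, hab]
  have hnorm : ∀ c, ‖f c‖ = ‖e c‖ := fun c => by
    rw [norm_eq_sqrt_re_inner (𝕜 := ℂ), norm_eq_sqrt_re_inner (𝕜 := ℂ), hinner]
  have hW : ∀ c, f.extendOfNorm e (e c) = f c :=
    LinearMap.extendOfNorm_eq hdense ⟨1, fun c => by rw [hnorm, one_mul]⟩
  refine ⟨⟨(f.extendOfNorm e).toLinearMap, fun x => ?_⟩, fun i => ?_⟩
  · refine hdense.induction_on (p := fun x => ‖f.extendOfNorm e x‖ = ‖x‖) x
      (isClosed_eq (by fun_prop) continuous_norm) fun c => ?_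
    rw [hW, hnorm]
  · have := hW (Finsupp.single i 1)
    simpa [e, f] using this

end GramIsometry

/-! ### Slices of a dilation -/

section Dilations

variable {H₁ : Type*} [NormedAddCommGroup H₁] [InnerProductSpace ℂ H₁] [CompleteSpace H₁]
variable {H₂ : Type*} [NormedAddCommGroup H₂] [InnerProductSpace ℂ H₂] [CompleteSpace H₂]
variable {K₁ : Type*} [NormedAddCommGroup K₁] [InnerProductSpace ℂ K₁] [CompleteSpace K₁]
variable {K₂ : Type*} [NormedAddCommGroup K₂] [InnerProductSpace ℂ K₂] [CompleteSpace K₂]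
variable {M₁ : VonNeumannAlgebra H₁} {M₂ : VonNeumannAlgebra H₂}
variable {𝒱 : Type*} [NormedAddCommGroup 𝒱] [InnerProductSpace ℂ 𝒱] [CompleteSpace 𝒱]

/-- Testing a dilation on elementary maps: the matrix elements of the slices of `F A` between the
vectors `(u* ⊗ I) V v` that span the dilation space are determined by the supermap alone. -/
theorem IsDilation.inner_slice {S : CB M₁ (fullVN K₁) →ₗ[ℂ] CB M₂ (fullVN K₂)}
    {V : K₂ →ₗᵢ[ℂ] HTensor K₁ 𝒱} {F : M₂ →ₗ[ℂ] vnTensor M₁ (fullVN 𝒱)}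
    (hVF : IsDilation S V F) (A : M₂) (h h' : H₁) (u u' : K₁) (v v' : K₂) :
    ⟪htmul h (contractL 𝒱 u (V v)), (F A).1 (htmul h' (contractL 𝒱 u' (V v')))⟫_ℂ =
      ⟪v, ((S (elemMap M₁ h h' u u')).1 A).1 v'⟫_ℂ := by
  rw [hVF.2, ampl_elemMap]
  simp only [ContinuousLinearMap.comp_apply, ContinuousLinearMap.adjoint_inner_right]
  rw [← inner_sliceL, contractL, contractL, ContinuousLinearMap.adjoint_inner_left]
  rfl

end Dilations

/-! ### Operators and dense spans -/

section DenseSpan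

variable {V : Type*} [NormedAddCommGroup V] [InnerProductSpace ℂ V]

/-- A bounded operator is determined by its matrix elements along a family with dense span. -/
theorem ext_inner_of_dense_span {ι : Type*} {a : ι → V}
    (ha : (Submodule.span ℂ (Set.range a)).topologicalClosure = ⊤) {B C : V →L[ℂ] V}
    (h : ∀ i j, ⟪a i, B (a j)⟫_ℂ = ⟪a i, C (a j)⟫_ℂ) : B = C := by
  have hd := Submodule.dense_iff_topologicalClosure_eq_top.2 ha
  refine ContinuousLinearMap.ext_on hd ?_
  rintro _ ⟨j, rfl⟩
  have : innerSL ℂ (B (a j)) = innerSL ℂ (C (a j)) := by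
    refine ContinuousLinearMap.ext_on hd ?_
    rintro _ ⟨i, rfl⟩
    simpa using congrArg (starRingEnd ℂ) (h i j)
  refine ext_inner_right ℂ fun v => ?_
  simpa using congrArg (fun f => f v) this

end DenseSpan

/-! ### Operators of the form `I ⊗ W` -/

section Intertwining

variable {H : Type*} [NormedAddCommGroup H] [InnerProductSpace ℂ H]
variable {K : Type*} [NormedAddCommGroup K] [InnerProductSpace ℂ K]
variable {G : Type*} [NormedAddCommGroup G] [InnerProductSpace ℂ G]
variable {𝒱 : Type*} [NormedAddCommGroup 𝒱] [InnerProductSpace ℂ 𝒱] [CompleteSpace 𝒱]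
variable {𝒱' : Type*} [NormedAddCommGroup 𝒱'] [InnerProductSpace ℂ 𝒱'] [CompleteSpace 𝒱']

theorem contractL_opTensor_id (W : 𝒱 →L[ℂ] 𝒱') (u : K) (z : HTensor K 𝒱) :
    contractL 𝒱' u (opTensor (ContinuousLinearMap.id ℂ K) W z) = W (contractL 𝒱 u z) := by
  have : (contractL 𝒱' u).comp (opTensor (ContinuousLinearMap.id ℂ K) W) =
      W.comp (contractL 𝒱 u) := hext fun x y => by simp
  exact congrArg (fun f => f z) this

theorem range_contractL {K₁ : Type*} [NormedAddCommGroup K₁] [InnerProductSpace ℂ K₁]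
    {K₂ : Type*} [NormedAddCommGroup K₂] [InnerProductSpace ℂ K₂] (V : K₂ →ₗᵢ[ℂ] HTensor K₁ 𝒱) :
    Set.range (fun p : K₁ × K₂ => contractL 𝒱 p.1 (V p.2)) =
      {w : 𝒱 | ∃ (u : K₁) (v : K₂), w = contractL 𝒱 u (V v)} := by
  ext w
  simp [eq_comm]

/-- `T' = (I ⊗ W) T` can be tested after contracting with the vectors of the first factor. -/
theorem eq_opTensor_id_comp_iff {T : G →L[ℂ] HTensor K 𝒱} {T' : G →L[ℂ] HTensor K 𝒱'}
    {W : 𝒱 →L[ℂ] 𝒱'} :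
    T' = (opTensor (ContinuousLinearMap.id ℂ K) W).comp T ↔
      ∀ u v, W (contractL 𝒱 u (T v)) = contractL 𝒱' u (T' v) := by
  constructor
  · rintro rfl u v
    exact (contractL_opTensor_id W u _).symm
  · intro h
    refine ContinuousLinearMap.ext fun v => hext_inner fun x y => ?_
    rw [← insL_apply, ← ContinuousLinearMap.adjoint_inner_right,
      ← ContinuousLinearMap.adjoint_inner_right]
    change ⟪y, contractL 𝒱' x _⟫_ℂ = ⟪y, contractL 𝒱' x _⟫_ℂ
    rw [ContinuousLinearMap.comp_apply, contractL_opTensor_id, h]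

theorem inner_opTensor_id_adjoint (W : 𝒱 →L[ℂ] 𝒱') (x : H) (y : 𝒱)
    (z : HTensor H 𝒱') :
    ⟪htmul x y, opTensor (ContinuousLinearMap.id ℂ H) (ContinuousLinearMap.adjoint W) z⟫_ℂ =
      ⟪htmul x (W y), z⟫_ℂ := by
  have : (innerSL ℂ (htmul x y)).comp
      (opTensor (ContinuousLinearMap.id ℂ H) (ContinuousLinearMap.adjoint W)) =
      innerSL ℂ (htmul x (W y)) := hext fun x' y' => by
    simp [ContinuousLinearMap.adjoint_inner_right]
  exact congrArg (fun f => f z) this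

end Intertwining

end QSupermap

end

theorem mainTheorem2
    {H₁ : Type*} [NormedAddCommGroup H₁] [InnerProductSpace ℂ H₁] [CompleteSpace H₁]
    [TopologicalSpace.SeparableSpace H₁] [Nontrivial H₁]
    {H₂ : Type*} [NormedAddCommGroup H₂] [InnerProductSpace ℂ H₂] [CompleteSpace H₂]
    [TopologicalSpace.SeparableSpace H₂]
    {K₁ : Type*} [NormedAddCommGroup K₁] [InnerProductSpace ℂ K₁] [CompleteSpace K₁]
    [TopologicalSpace.SeparableSpace K₁]
    {K₂ : Type*} [NormedAddCommGroup K₂] [InnerProductSpace ℂ K₂] [CompleteSpace K₂]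
    [TopologicalSpace.SeparableSpace K₂]
    {𝒱 : Type*} [NormedAddCommGroup 𝒱] [InnerProductSpace ℂ 𝒱] [CompleteSpace 𝒱]
    [TopologicalSpace.SeparableSpace 𝒱]
    {𝒱' : Type*} [NormedAddCommGroup 𝒱'] [InnerProductSpace ℂ 𝒱'] [CompleteSpace 𝒱']
    [TopologicalSpace.SeparableSpace 𝒱']
    (M₁ : VonNeumannAlgebra H₁) (M₂ : VonNeumannAlgebra H₂)
    (S : CB M₁ (fullVN K₁) →ₗ[ℂ] CB M₂ (fullVN K₂)) (hS : IsDeterministicSupermap S)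
    (V : K₂ →ₗᵢ[ℂ] HTensor K₁ 𝒱) (F : M₂ →ₗ[ℂ] vnTensor M₁ (fullVN 𝒱))
    (V' : K₂ →ₗᵢ[ℂ] HTensor K₁ 𝒱') (F' : M₂ →ₗ[ℂ] vnTensor M₁ (fullVN 𝒱'))
    (hVF : IsDilation S V F) (hmin : IsMinimal V) (hVF' : IsDilation S V' F') :
    ∃ W : 𝒱 →ₗᵢ[ℂ] 𝒱',
      V'.toContinuousLinearMap =
        (opTensor (ContinuousLinearMap.id ℂ K₁) W.toContinuousLinearMap).comp
          V.toContinuousLinearMap ∧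
      (∀ U : 𝒱 →ₗᵢ[ℂ] 𝒱',
        V'.toContinuousLinearMap =
          (opTensor (ContinuousLinearMap.id ℂ K₁) U.toContinuousLinearMap).comp
            V.toContinuousLinearMap → U = W) ∧
      (∀ A : M₂, (F A).1 =
        (opTensor (ContinuousLinearMap.id ℂ H₁)
            (ContinuousLinearMap.adjoint W.toContinuousLinearMap)).comp
          ((F' A).1.comp (opTensor (ContinuousLinearMap.id ℂ H₁) W.toContinuousLinearMap))) ∧
      (IsMinimal V' → ∃ U : 𝒱 ≃ₗᵢ[ℂ] 𝒱', U.toLinearIsometry = W ∧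
        ∀ A : M₂, (F' A).1 =
          (opTensor (ContinuousLinearMap.id ℂ H₁) W.toContinuousLinearMap).comp
            ((F A).1.comp (opTensor (ContinuousLinearMap.id ℂ H₁)
              (ContinuousLinearMap.adjoint W.toContinuousLinearMap)))) := by
  let a : K₁ × K₂ → 𝒱 := fun p => contractL 𝒱 p.1 (V p.2)
  let b : K₁ × K₂ → 𝒱' := fun p => contractL 𝒱' p.1 (V' p.2)
  have ha : (Submodule.span ℂ (Set.range a)).topologicalClosure = ⊤ := by
    rw [range_contractL]
    exact hmin
  have key : ∀ (A : M₂) (h h' : H₁) (p q : K₁ × K₂),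
      ⟪htmul h (a p), (F A).1 (htmul h' (a q))⟫_ℂ =
        ⟪htmul h (b p), (F' A).1 (htmul h' (b q))⟫_ℂ := fun A h h' p q => by
    rw [hVF.inner_slice, hVF'.inner_slice]
  -- This is where `H₁ ≠ 0` enters: a unit vector recovers the Gram matrix of `a` from `F 1 = 1`.
  obtain ⟨h₀, hh₀⟩ := exists_norm_eq H₁ zero_le_one
  have hab : ∀ p q, ⟪a p, a q⟫_ℂ = ⟪b p, b q⟫_ℂ := fun p q => by
    have h := key 1 h₀ h₀ p q
    rw [hVF.1.2, hVF'.1.2] at h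
    simpa [inner_self_eq_norm_sq_to_K, hh₀] using h
  obtain ⟨W, hW⟩ := exists_linearIsometry_of_inner_eq a b hab ha
  have hF : ∀ A : M₂, (F A).1 =
      (opTensor (ContinuousLinearMap.id ℂ H₁)
          (ContinuousLinearMap.adjoint W.toContinuousLinearMap)).comp
        ((F' A).1.comp (opTensor (ContinuousLinearMap.id ℂ H₁) W.toContinuousLinearMap)) := by
    intro A
    refine hext fun h' y' => hext_inner fun h y => ?_
    have hs : (sliceL M₁ (fullVN 𝒱) h h' (F A)).1 =
        (ContinuousLinearMap.adjoint W.toContinuousLinearMap).comp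
          ((sliceL M₁ (fullVN 𝒱') h h' (F' A)).1.comp W.toContinuousLinearMap) := by
      refine ext_inner_of_dense_span ha fun p q => ?_
      simp only [ContinuousLinearMap.comp_apply, ContinuousLinearMap.adjoint_inner_right,
        inner_sliceL, LinearIsometry.coe_toContinuousLinearMap, hW, key]
    have hy := congrArg (fun B => ⟪y, B y'⟫_ℂ) hs
    simpa only [ContinuousLinearMap.comp_apply, ContinuousLinearMap.adjoint_inner_right,
      inner_sliceL, inner_opTensor_id_adjoint, opTensor_htmul, ContinuousLinearMap.id_apply]
      using hy
  refine ⟨W, eq_opTensor_id_comp_iff.2 fun u v => hW (u, v), fun U hU => ?_, hF, fun hmin' => ?_⟩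
  · refine LinearIsometry.toContinuousLinearMap_injective (ContinuousLinearMap.ext_on
      (Submodule.dense_iff_topologicalClosure_eq_top.2 ha) ?_)
    rintro _ ⟨⟨u, v⟩, rfl⟩
    exact (eq_opTensor_id_comp_iff.1 hU u v).trans (hW (u, v)).symm
  · -- The range of an isometry on a complete space is closed; here it also contains a dense span.
    have hsurj : Function.Surjective W := by
      rw [← Set.range_eq_univ]
      refine (W.isometry.isClosedEmbedding.isClosed_range.closure_eq).symm.trans
        (Dense.closure_eq (Dense.mono (s₁ := (Submodule.span ℂ (Set.range b) : Set 𝒱')) ?_ ?_))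
      · rw [← LinearIsometry.coe_toLinearMap, ← LinearMap.coe_range]
        refine Submodule.span_le.2 ?_
        rintro _ ⟨p, rfl⟩
        exact ⟨a p, hW p⟩
      · rw [Submodule.dense_iff_topologicalClosure_eq_top, range_contractL]
        exact hmin'
    have hWW : (opTensor (ContinuousLinearMap.id ℂ H₁) W.toContinuousLinearMap).comp
        (opTensor (ContinuousLinearMap.id ℂ H₁)
          (ContinuousLinearMap.adjoint W.toContinuousLinearMap)) =
        ContinuousLinearMap.id ℂ _ := by
      refine hext fun x y => ?_
      obtain ⟨y, rfl⟩ := hsurj y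
      have : ContinuousLinearMap.adjoint W.toContinuousLinearMap (W y) = y :=
        ext_inner_left ℂ fun w => by simp [ContinuousLinearMap.adjoint_inner_right]
      simp [this]
    refine ⟨LinearIsometryEquiv.ofSurjective W hsurj, LinearIsometry.ext fun _ => rfl, fun A => ?_⟩
    rw [hF]
    ext z
    simp only [ContinuousLinearMap.ext_iff, ContinuousLinearMap.comp_apply,
      ContinuousLinearMap.id_apply] at hWW
    simp only [ContinuousLinearMap.comp_apply, hWW]
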